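/- Let $\Bbbk$ be an infinite field and let $S\subseteq\mathbb N$ be a numerical semigroup, i.e. a submonoid of $(\mathbb N,+)$ with finite complement. Let $g_1<\dots<g_\nu$ be its minimal generators, that is, the minimal elements of $S\setminus\{0\}$ for the order $s\preceq t\iff t-s\in S$; so $\nu$ is the embedding dimension of $S$, and let $m=g_1=\min(S\setminus\{0\})$ be its multiplicity. Let $R=\Bbbk[[t^S]]=\Bbbk[[t^{g_1},\dots,t^{g_\nu}]]$ be the numerical semigroup ring, $\mathfrak m$ its maximal ideal, and $\mathrm{gr}_{\mathfrak m}(R)=\bigoplus_{i\ge 0}\mathfrak m^i/\mathfrak m^{i+1}$. Let $I^*$ be the kernel of the $\Bbbk$-algebra homomorphism $\Bbbk[x_1,\dots,x_\nu]\to\mathrm{gr}_{\mathfrak m}(R)$ that sends $x_i$ to the class of $t^{g_i}$ in $\mathfrak m/\mathfrak m^2$. Call $\mathrm{gr}_{\mathfrak m}(R)$ a complete intersection if the minimal number of generators of the ideal $I^*$ is $\nu-1$. For a positive integer $x$ let $\ell(x)$ be the number of prime factors of $x$ counted with multiplicity. If $\mathrm{gr}_{\mathfrak m}(R)$ is a complete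 intersection, then: (1) $\nu\le \ell(m)+1$; (2) if $m$ is a prime number, then $\nu=2$. -/

import Mathlib

open PowerSeries in
/-- The numerical semigroup ring `k⟦t^S⟧`: the power series over `k` whose exponents lie in `S`. -/
noncomputable def semigroupRing (k : Type*) [Field k] (S : AddSubmonoid ℕ) :
    Subalgebra k (PowerSeries k) where
  carrier := {f | ∀ n, coeff n f ≠ 0 → n ∈ S}
  mul_mem' := by
    intro f g hf hg n hn
    rw [coeff_mul] at hn
    obtain ⟨p, hp, hne⟩ := Finset.exists_ne_zero_of_sum_ne_zero hn
    rw [← Finset.HasAntidiagonal.mem_antidiagonal.mp hp]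
    exact S.add_mem (hf _ (left_ne_zero_of_mul hne)) (hg _ (right_ne_zero_of_mul hne))
  add_mem' := by
    intro f g hf hg n hn
    by_cases h : coeff n f = 0
    · refine hg n fun h' => hn ?_
      rw [map_add, h, h', add_zero]
    · exact hf n h
  algebraMap_mem' := by
    intro c n hn
    rw [PowerSeries.algebraMap_apply, Algebra.algebraMap_self, RingHom.id_apply, coeff_C] at hn
    have h0 : n = 0 := by
      by_contra h
      exact hn (if_neg h)
    rw [h0]
    exact S.zero_mem

theorem semigroupRing_isUnit_iff {k : Type*} [Field k] {S : AddSubmonoid ℕ}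
    (f : semigroupRing k S) :
    IsUnit f ↔ PowerSeries.constantCoeff (f : PowerSeries k) ≠ 0 := by
  constructor
  · intro h
    exact ((h.map (semigroupRing k S).val).map (PowerSeries.constantCoeff (R := k))).ne_zero
  · intro h
    have hinv : (f : PowerSeries k)⁻¹ ∈ semigroupRing k S := by
      intro n
      induction n using Nat.strong_induction_on with
      | _ n ih =>
        intro hn
        rw [PowerSeries.coeff_inv] at hn
        by_cases h0 : n = 0
        · rw [h0]; exact S.zero_mem
        · rw [if_neg h0] at hn
          obtain ⟨p, hp, hne⟩ := Finset.exists_ne_zero_of_sum_ne_zero (right_ne_zero_of_mul hn)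
          by_cases hlt : p.2 < n
          · rw [if_pos hlt] at hne
            rw [← Finset.HasAntidiagonal.mem_antidiagonal.mp hp]
            exact S.add_mem (f.2 _ (left_ne_zero_of_mul hne)) (ih _ hlt (right_ne_zero_of_mul hne))
          · exact absurd (if_neg hlt) hne
    exact IsUnit.of_mul_eq_one ⟨_, hinv⟩ (Subtype.ext (PowerSeries.mul_inv_cancel _ h))

instance semigroupRing.isLocalRing (k : Type*) [Field k] (S : AddSubmonoid ℕ) :
    IsLocalRing (semigroupRing k S) :=
  IsLocalRing.of_nonunits_add (by
    intro a b ha hb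
    rw [mem_nonunits_iff, semigroupRing_isUnit_iff, not_not] at ha hb ⊢
    rw [Subalgebra.coe_add, map_add, ha, hb, add_zero])

/-- The associated graded ring `⨁ᵢ 𝔪ⁱ / 𝔪ⁱ⁺¹` of a local ring `(R, 𝔪)`, realised as the quotient
of the Rees algebra `⨁ᵢ 𝔪ⁱ Xⁱ ⊆ R[X]` by the ideal `⨁ᵢ 𝔪ⁱ⁺¹ Xⁱ` that `𝔪` generates in it. -/
abbrev assocGraded (R : Type*) [CommRing R] [IsLocalRing R] : Type _ :=
  reesAlgebra (IsLocalRing.maximalIdeal R) ⧸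
    (IsLocalRing.maximalIdeal R).map
      (algebraMap R (reesAlgebra (IsLocalRing.maximalIdeal R)))

/-- An element `∑ fᵢ Xⁱ` of the Rees algebra vanishes in `assocGraded R` exactly when each `fᵢ`
lies in `𝔪ⁱ⁺¹`; so the degree `i` part of `assocGraded R` is `𝔪ⁱ / 𝔪ⁱ⁺¹`. -/
theorem assocGraded.mk_eq_zero_iff {R : Type*} [CommRing R] [IsLocalRing R]
    (f : reesAlgebra (IsLocalRing.maximalIdeal R)) :
    (Ideal.Quotient.mk _ f : assocGraded R) = 0 ↔
      ∀ i, (f : Polynomial R).coeff i ∈ IsLocalRing.maximalIdeal R ^ (i + 1) := by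
  rw [Ideal.Quotient.eq_zero_iff_mem]
  constructor
  · intro hf
    refine Submodule.span_induction (p := fun (x : reesAlgebra (IsLocalRing.maximalIdeal R)) _ =>
      ∀ i, (x : Polynomial R).coeff i ∈ IsLocalRing.maximalIdeal R ^ (i + 1)) ?_ ?_ ?_ ?_ hf
    · rintro _ ⟨a, ha, rfl⟩ i
      change (Polynomial.C a).coeff i ∈ _
      rw [Polynomial.coeff_C]
      split_ifs with h
      · rw [h, zero_add, pow_one]; exact ha
      · exact Ideal.zero_mem _
    · intro i
      exact Ideal.zero_mem _
    · intro x y _ _ hx hy i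
      rw [Subalgebra.coe_add, Polynomial.coeff_add]
      exact Ideal.add_mem _ (hx i) (hy i)
    · intro a x _ hx i
      rw [smul_eq_mul, Subalgebra.coe_mul, Polynomial.coeff_mul]
      refine Ideal.sum_mem _ fun p hp => ?_
      rw [← Finset.HasAntidiagonal.mem_antidiagonal.mp hp, add_assoc, pow_add]
      exact Ideal.mul_mem_mul (a.2 p.1) (hx p.2)
  · intro h
    have key : ∀ i, ∃ y ∈ (IsLocalRing.maximalIdeal R).map
        (algebraMap R (reesAlgebra (IsLocalRing.maximalIdeal R))),
        (y : Polynomial R) = Polynomial.monomial i ((f : Polynomial R).coeff i) := by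
      intro i
      have hr := h i
      rw [pow_succ'] at hr
      refine Submodule.mul_induction_on (C := fun r => ∃ y ∈ (IsLocalRing.maximalIdeal R).map
        (algebraMap R (reesAlgebra (IsLocalRing.maximalIdeal R))),
        (y : Polynomial R) = Polynomial.monomial i r) hr ?_ ?_
      · intro a ha b hb
        have hb' := reesAlgebra.monomial_mem.mpr hb
        refine ⟨algebraMap R (reesAlgebra (IsLocalRing.maximalIdeal R)) a *
          ⟨Polynomial.monomial i b, hb'⟩,
          Ideal.mul_mem_right _ _ (Ideal.mem_map_of_mem _ ha), ?_⟩
        rw [Subalgebra.coe_mul, Subalgebra.coe_algebraMap, Polynomial.algebraMap_eq]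
        exact Polynomial.C_mul_monomial
      · rintro a b ⟨y, hy, hya⟩ ⟨z, hz, hzb⟩
        exact ⟨y + z, Ideal.add_mem _ hy hz, by rw [Subalgebra.coe_add, hya, hzb, map_add]⟩
    choose y hy hye using key
    have hf : f = ∑ i ∈ (f : Polynomial R).support, y i := by
      apply Subtype.ext
      rw [AddSubmonoidClass.coe_finsetSum]
      conv_lhs => rw [(f : Polynomial R).as_sum_support]
      exact Finset.sum_congr rfl fun i _ => (hye i).symm
    rw [hf]
    exact Ideal.sum_mem _ fun i _ => hy i

/-- The class of `r ∈ 𝔪` in the degree one part `𝔪 / 𝔪²` of the associated graded ring. -/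
noncomputable def assocGraded.degOne {R : Type*} [CommRing R] [IsLocalRing R]
    (r : R) (hr : r ∈ IsLocalRing.maximalIdeal R) : assocGraded R :=
  Ideal.Quotient.mk _
    ⟨Polynomial.monomial 1 r, reesAlgebra.monomial_mem.mpr (by rwa [pow_one])⟩

/-- The minimal generators of `S`: the minimal elements of `S \ {0}` for the order
`s ≼ t ↔ ∃ u ∈ S, t = s + u`. -/
def minimalGenerators (S : AddSubmonoid ℕ) : Set ℕ :=
  {g | g ∈ S ∧ g ≠ 0 ∧ ∀ s ∈ S, s ≠ 0 → (∃ u ∈ S, g = s + u) → s = g}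

/-- The embedding dimension `ν`: the number of minimal generators. -/
noncomputable def embeddingDimension (S : AddSubmonoid ℕ) : ℕ :=
  (minimalGenerators S).ncard

/-- The multiplicity `m`: the least positive element. -/
noncomputable def multiplicityOf (S : AddSubmonoid ℕ) : ℕ :=
  sInf {s | s ∈ S ∧ 0 < s}

/-- The element `t^s` of `k⟦t^S⟧`, for `s ∈ S`. -/
noncomputable def tPow (k : Type*) [Field k] {S : AddSubmonoid ℕ} (s : ℕ) (hs : s ∈ S) :
    semigroupRing k S :=
  ⟨PowerSeries.X ^ s, by
    intro n hn
    rw [PowerSeries.coeff_X_pow] at hn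
    have h : n = s := by
      by_contra h
      exact hn (if_neg h)
    rw [h]
    exact hs⟩

theorem tPow_mem_maximalIdeal (k : Type*) [Field k] {S : AddSubmonoid ℕ} (s : ℕ) (hs : s ∈ S)
    (h0 : s ≠ 0) : tPow k s hs ∈ IsLocalRing.maximalIdeal (semigroupRing k S) := by
  rw [IsLocalRing.mem_maximalIdeal, mem_nonunits_iff, semigroupRing_isUnit_iff, not_not]
  change PowerSeries.constantCoeff (PowerSeries.X ^ s : PowerSeries k) = 0
  rw [map_pow, PowerSeries.constantCoeff_X, zero_pow h0]

/-- The canonical presentation `k[x_g : g a minimal generator] → gr_𝔪(k⟦t^S⟧)`, which sends `x_g`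
to the class of `t^g` in `𝔪 / 𝔪²`. -/
noncomputable def grPresentation (k : Type*) [Field k] (S : AddSubmonoid ℕ) :
    MvPolynomial (minimalGenerators S) k →ₐ[k] assocGraded (semigroupRing k S) :=
  MvPolynomial.aeval fun g =>
    assocGraded.degOne (tPow k g.1 g.2.1) (tPow_mem_maximalIdeal k g.1 g.2.1 g.2.2.1)

/-- The defining ideal of `gr_𝔪(k⟦t^S⟧)` in the polynomial ring, that is, the kernel of the
canonical presentation. -/
noncomputable def grDefiningIdeal (k : Type*) [Field k] (S : AddSubmonoid ℕ) :
    Ideal (MvPolynomial (minimalGenerators S) k) :=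
  RingHom.ker (grPresentation k S)

/-- `gr_𝔪(k⟦t^S⟧)` is a complete intersection: the minimal number of generators of its defining
ideal is `ν - 1`. -/
def GrIsCompleteIntersection (k : Type*) [Field k] (S : AddSubmonoid ℕ) : Prop :=
  Submodule.spanFinrank (grDefiningIdeal k S) + 1 = embeddingDimension S

/-! A Gröbner basis made of pure-power relations shows that `m` is a product of `ν - 1` factors,
each at least `2`. For every minimal generator `g_i ≠ m`, let `c_i` be the least exponent such that
`x_i ^ c_i` has a different factorization `b_i` of length at least `c_i` (`exists_least_power`);
then `c_i ≥ 2`. This gives a form `f_i` in `I^*`: `x_i ^ c_i - x ^ b_i` if the lengths agree, `x_i ^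
c_i` if `b_i` is longer.

By minimality of `c_i`, taking the coefficient of `x_i ^ c_i` kills `𝔫 I^*`, where `𝔫` is the ideal
of the variables, and these functionals are dual to the `f_i`. Since `I^*` has `ν - 1` generators,
graded Nakayama (`MvPolynomial.eq_span_of_dual_family`) makes the `f_i` generate it.

Strict convexity of the square (`weight_sq_sub_sq_lt`) gives a weight for which each `x_i ^ c_i`
leads `f_i`. The leading terms are pairwise coprime, so the monomials with all exponents below `c_i`
are independent modulo `I^*` (`MvPolynomial.exists_linearMap_of_coprime_rules`). Hence each element
of `S` has exactly one factorization with these bounds, and counting residues modulo `m` yields `∏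
c_i = m` (`prod_eq_of_existsUnique_factorization`). Both claims follow by counting prime factors. -/

open MvPolynomial

/-! ### Graded Nakayama with dual functionals -/

/-- A graded form of Nakayama's lemma: homogeneous elements of a homogeneous ideal `I` that are
dual to functionals vanishing on `𝔫 I` generate `I` as soon as there are enough of them. -/
theorem MvPolynomial.eq_span_of_dual_family {σ ι k : Type*} [Field k] [Fintype ι] [DecidableEq ι]
    (I : Ideal (MvPolynomial σ k)) (hI : ∀ p ∈ I, ∀ d, homogeneousComponent d p ∈ I)
    (f : ι → MvPolynomial σ k) (n : ι → ℕ) (hfI : ∀ i, f i ∈ I)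
    (hf : ∀ i, (f i).IsHomogeneous (n i)) (φ : ι → MvPolynomial σ k →ₗ[k] k)
    (hφX : ∀ i j, ∀ q ∈ I, φ i (q * X j) = 0)
    (hφf : ∀ i j, φ i (f j) = if i = j then 1 else 0)
    (h : ι → MvPolynomial σ k) (hh : Ideal.span (Set.range h) = I) :
    I = Ideal.span (Set.range f) := by
  have hhI : ∀ i, h i ∈ I := fun i => hh ▸ Ideal.subset_span ⟨i, rfl⟩
  -- On `I`, each `φ i` factors through `I / 𝔫 I`, so only the constant term of a multiplier counts.
  have hmul : ∀ i, ∀ q ∈ I, ∀ r, φ i (r * q) = constantCoeff r * φ i q := by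
    intro i q hq r
    induction r using MvPolynomial.induction_on with
    | C a => rw [← smul_eq_C_mul, map_smul, constantCoeff_C, smul_eq_mul]
    | add p r hp hr => rw [add_mul, map_add, hp, hr, map_add, add_mul]
    | mul_X p j _ =>
      rw [mul_right_comm, hφX i j _ (I.mul_mem_left _ hq), map_mul, constantCoeff_X, mul_zero,
        zero_mul]
  have hrep : ∀ p ∈ I, ∃ a : ι → MvPolynomial σ k, ∑ i, a i * h i = p := by
    intro p hp
    rw [← hh] at hp
    exact Ideal.mem_span_range_iff_exists_fun.mp hp
  -- the functionals separate the generators `h`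
  let T : (ι → k) →ₗ[k] (ι → k) :=
    LinearMap.pi fun i => ∑ l, φ i (h l) • LinearMap.proj l
  have hT : ∀ v i, T v i = ∑ l, φ i (h l) * v l := by
    intro v i
    simp [T]
  have hφT : ∀ (a : ι → MvPolynomial σ k) (i : ι),
      φ i (∑ l, a l * h l) = T (fun l => constantCoeff (a l)) i := by
    intro a i
    rw [hT, map_sum]
    exact Finset.sum_congr rfl fun l _ => by rw [hmul i _ (hhI l), mul_comm]
  have hsurj : Function.Surjective T := by
    intro v
    obtain ⟨a, ha⟩ := hrep (∑ j, C (v j) * f j)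
      (I.sum_mem fun j _ => I.mul_mem_left _ (hfI j))
    refine ⟨fun l => constantCoeff (a l), _root_.funext fun i => ?_⟩
    rw [← hφT, ha, map_sum]
    simp [hmul i _ (hfI _), hφf]
  -- `T` is a square matrix because `f` and `h` share the index type; this is where the number of
  -- generators enters.
  have hinj : Function.Injective T := LinearMap.injective_iff_surjective.mpr hsurj
  set J := Ideal.span (Set.range f) with hJ
  have hfJ : ∀ i, f i ∈ J := fun i => Ideal.subset_span ⟨i, rfl⟩
  have key : ∀ d, ∀ p ∈ I, p.IsHomogeneous d → p ∈ J := by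
    intro d
    induction d using Nat.strong_induction_on with
    | _ d ih =>
    intro p hp hpd
    have hp' : p - ∑ j, C (φ j p) * f j ∈ I :=
      I.sub_mem hp (I.sum_mem fun j _ => I.mul_mem_left _ (hfI j))
    obtain ⟨a, ha⟩ := hrep _ hp'
    -- Every `φ i` vanishes on `p - ∑ φ_j(p) f_j`, so injectivity of `T` puts this difference in `𝔫
    -- I`.
    have ha0 : ∀ l, constantCoeff (a l) = 0 := by
      have : (fun l => constantCoeff (a l)) = 0 := by
        refine hinj (_root_.funext fun i => ?_)
        rw [map_zero, ← hφT, ha, map_sub, map_sum]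
        simp [hmul i _ (hfI _), hφf]
      exact fun l => congrFun this l
    have hpeq : p = ∑ l, a l * h l + ∑ j, C (φ j p) * f j := by rw [ha]; ring
    have hcomp : p = homogeneousComponent d p := by
      rw [homogeneousComponent_of_mem hpd, if_pos rfl]
    rw [hcomp, hpeq, map_add, map_sum, map_sum]
    refine J.add_mem (J.sum_mem fun l _ => ?_) (J.sum_mem fun j _ => ?_)
    · rw [← sum_homogeneousComponent (a l), ← sum_homogeneousComponent (h l), Finset.sum_mul_sum,
        map_sum]
      refine J.sum_mem fun i _ => ?_
      rw [map_sum]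
      refine J.sum_mem fun j _ => ?_
      rw [homogeneousComponent_of_mem
        ((homogeneousComponent_isHomogeneous i (a l)).mul
          (homogeneousComponent_isHomogeneous j (h l)))]
      split_ifs with hd
      -- The degree zero part of `a l` is zero, so only components of `h l` of degree below `d`
      -- contribute, and induction covers those.
      · rcases Nat.eq_zero_or_pos i with rfl | hi
        · rw [homogeneousComponent_zero, ← constantCoeff_eq, ha0, C_0, zero_mul]
          exact J.zero_mem
        · exact J.mul_mem_left _ (ih j (by omega) _ (hI _ (hhI l) j)
            (homogeneousComponent_isHomogeneous j _))
      · exact J.zero_mem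
    · rw [← smul_eq_C_mul, map_smul, homogeneousComponent_of_mem (hf j), smul_eq_C_mul]
      refine J.mul_mem_left _ ?_
      split_ifs
      · exact hfJ j
      · exact J.zero_mem
  refine le_antisymm (fun p hp => ?_) (Ideal.span_le.mpr ?_)
  · rw [← sum_homogeneousComponent p]
    exact J.sum_mem fun d _ => key d _ (hI p hp d) (homogeneousComponent_isHomogeneous d p)
  · rintro _ ⟨i, rfl⟩
    exact hfI i

/-! ### Rewriting with coprime leading monomials -/

section Reduction
variable {σ ι k : Type*} [Field k]

open Classical in
/-- The normal form of the monomial `x ^ a` under the rewriting rules `x ^ l i → ε i • x ^ u i`,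
which terminate because they lower the weight `μ`. -/
noncomputable def monomialNormalForm (l u : ι → σ →₀ ℕ) (ε : ι → k) (μ : (σ →₀ ℕ) →+ ℕ)
    (hμ : ∀ i, μ (u i) < μ (l i)) (a : σ →₀ ℕ) : MvPolynomial σ k :=
  if h : ∃ i, l i ≤ a then
    ε h.choose • monomialNormalForm l u ε μ hμ (a - l h.choose + u h.choose)
  else monomial a 1
termination_by μ a
decreasing_by
  have h1 := hμ h.choose
  have h2 : μ a = μ (a - l h.choose) + μ (l h.choose) := by
    rw [← map_add, tsub_add_cancel_of_le h.choose_spec]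
  rw [map_add]
  omega

/-- This is confluence: two different rules that both apply act on disjoint parts of the monomial,
so they commute. Hence the rule picked by choice in the definition does not matter. -/
theorem monomialNormalForm_add (l u : ι → σ →₀ ℕ) (ε : ι → k) (μ : (σ →₀ ℕ) →+ ℕ)
    (hμ : ∀ i, μ (u i) < μ (l i))
    (hl : ∀ i j, i ≠ j → ∀ a, l i ≤ a → l j ≤ a → l i + l j ≤ a) (i : ι) (a : σ →₀ ℕ) :
    monomialNormalForm l u ε μ hμ (a + l i) = ε i • monomialNormalForm l u ε μ hμ (a + u i) := by
  induction hn : μ (a + l i) using Nat.strong_induction_on generalizing a i with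
  | _ n ih =>
  have hex : ∃ j, l j ≤ a + l i := ⟨i, le_add_self⟩
  have hstep : monomialNormalForm l u ε μ hμ (a + l i) = ε hex.choose •
      monomialNormalForm l u ε μ hμ (a + l i - l hex.choose + u hex.choose) := by
    conv_lhs => rw [monomialNormalForm]
    rw [dif_pos hex]
  have hspec := hex.choose_spec
  generalize hex.choose = j at hstep hspec
  rw [hstep]
  by_cases hij : i = j
  · subst hij
    rw [add_tsub_cancel_right]
  -- Coprimality writes the monomial as `b + l j + l i`. Both one-step reductions have lower weight,
  -- and by induction both lead on to `b + u i + u j`.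
  · obtain ⟨b, hb⟩ := le_iff_exists_add'.mp (hl i j hij _ le_add_self hspec)
    obtain rfl : a = b + l j := by
      refine add_right_cancel (b := l i) ?_
      rw [hb, add_assoc, add_comm (l j)]
    have e1 : b + l j + l i - l j + u j = b + u j + l i := by
      rw [add_right_comm, add_tsub_cancel_right, add_right_comm]
    have hi := hμ i
    have hj := hμ j
    simp only [map_add] at hn
    rw [e1, add_right_comm b (l j) (u i), ih _ ?_ i (b + u j) rfl, ih _ ?_ j (b + u i) rfl,
      smul_comm, add_right_comm]
    · simp only [map_add]; omega
    · simp only [map_add]; omega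

/-- If terminating rewriting rules `x ^ l i → ε i • x ^ u i` have pairwise coprime left-hand sides,
then the monomials divisible by no `x ^ l i` are independent modulo the ideal they generate. -/
theorem MvPolynomial.exists_linearMap_of_coprime_rules (l u : ι → σ →₀ ℕ) (ε : ι → k)
    (μ : (σ →₀ ℕ) →+ ℕ) (hμ : ∀ i, μ (u i) < μ (l i))
    (hl : ∀ i j, i ≠ j → ∀ a, l i ≤ a → l j ≤ a → l i + l j ≤ a) :
    ∃ L : MvPolynomial σ k →ₗ[k] MvPolynomial σ k,
      (∀ a, (∀ i, ¬ l i ≤ a) → L (monomial a 1) = monomial a 1) ∧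
      ∀ p ∈ Ideal.span (Set.range fun i => monomial (l i) 1 - ε i • monomial (u i) (1 : k)),
        L p = 0 := by
  let L : MvPolynomial σ k →ₗ[k] MvPolynomial σ k :=
    (basisMonomials σ k).constr k (monomialNormalForm l u ε μ hμ)
  have hL : ∀ a, L (monomial a 1) = monomialNormalForm l u ε μ hμ a := by
    intro a
    have := (basisMonomials σ k).constr_basis k (monomialNormalForm l u ε μ hμ) a
    rwa [coe_basisMonomials] at this
  refine ⟨L, fun a ha => ?_, fun p hp => ?_⟩
  · rw [hL, monomialNormalForm, dif_neg (not_exists.mpr ha)]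
  · obtain ⟨c, hc⟩ := (Finsupp.mem_ideal_span_range_iff_exists_finsupp).mp hp
    rw [← hc, Finsupp.sum, map_sum]
    refine Finset.sum_eq_zero fun i _ => ?_
    generalize c i = q
    induction q using MvPolynomial.induction_on' with
    | monomial a r =>
      have e : monomial a r * (monomial (l i) 1 - ε i • monomial (u i) (1 : k)) =
          r • (monomial (a + l i) 1 - ε i • monomial (a + u i) 1) := by
        simp [mul_sub, monomial_mul, smul_sub, smul_monomial]
      rw [e, map_smul, map_sub, map_smul, hL, hL, monomialNormalForm_add l u ε μ hμ hl, sub_self,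
        smul_zero]
    | add p q hp hq => rw [add_mul, map_add, hp, hq, add_zero]

end Reduction

/-! ### Factorizations in a numerical semigroup -/

section NumericalSemigroup
variable {S : AddSubmonoid ℕ}

/-- The element `∑ a_g g` of `S` with factorization `a`. -/
noncomputable abbrev factorizationWeight (S : AddSubmonoid ℕ) :
    (minimalGenerators S →₀ ℕ) →+ ℕ :=
  Finsupp.weight fun g : minimalGenerators S => (g : ℕ)

theorem factorizationWeight_mem (a : minimalGenerators S →₀ ℕ) : factorizationWeight S a ∈ S := by
  rw [Finsupp.weight_apply]
  exact S.sum_mem fun i _ => S.nsmul_mem i.2.1 _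

theorem factorizationWeight_eq_zero_iff (a : minimalGenerators S →₀ ℕ) :
    factorizationWeight S a = 0 ↔ a = 0 := by
  constructor
  · intro h
    ext i
    by_contra hi
    have h1 := Finsupp.le_weight_of_ne_zero' (fun g : minimalGenerators S => (g : ℕ)) hi
    exact i.2.2.1 (Nat.le_zero.mp (h1.trans h.le))
  · rintro rfl
    exact map_zero _

theorem degree_le_factorizationWeight (a : minimalGenerators S →₀ ℕ) :
    a.degree ≤ factorizationWeight S a := by
  rw [Finsupp.weight_apply, Finsupp.degree_apply, Finsupp.sum]
  exact Finset.sum_le_sum fun i _ => Nat.le_mul_of_pos_right _ (Nat.pos_of_ne_zero i.2.2.1)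

theorem exists_factorization {s : ℕ} (hs : s ∈ S) : ∃ a, factorizationWeight S a = s := by
  induction s using Nat.strong_induction_on with
  | _ s ih =>
  by_cases h0 : s = 0
  · exact ⟨0, by rw [h0, map_zero]⟩
  by_cases hmin : s ∈ minimalGenerators S
  · exact ⟨Finsupp.single ⟨s, hmin⟩ 1, by simp [Finsupp.weight_single]⟩
  · have : ∃ t ∈ S, t ≠ 0 ∧ (∃ u ∈ S, s = t + u) ∧ t ≠ s := by
      by_contra! h
      exact hmin ⟨hs, h0, fun t ht ht0 hu => h t ht ht0 hu⟩
    obtain ⟨t, ht, ht0, ⟨u, hu, rfl⟩, hts⟩ := this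
    obtain ⟨a, ha⟩ := ih t (by omega) ht
    obtain ⟨b, hb⟩ := ih u (by omega) hu
    exact ⟨a + b, by rw [map_add, ha, hb]⟩

theorem eq_single_of_factorizationWeight_eq (i : minimalGenerators S)
    (a : minimalGenerators S →₀ ℕ) (ha : factorizationWeight S a = i) :
    a = Finsupp.single i 1 := by
  have ha0 : a ≠ 0 := by
    rintro rfl
    exact i.2.2.1 (by rw [← ha, map_zero])
  obtain ⟨j, hj⟩ := Finsupp.ne_iff.mp ha0
  have hle : Finsupp.single j 1 ≤ a := Finsupp.single_le_iff.mpr (Nat.one_le_iff_ne_zero.mpr hj)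
  obtain ⟨b, rfl⟩ := le_iff_exists_add.mp hle
  have hsplit : (i : ℕ) = j + factorizationWeight S b := by
    rw [← ha, map_add, Finsupp.weight_single, one_smul]
  have hji : (j : ℕ) = i := i.2.2.2 j j.2.1 j.2.2.1 ⟨_, factorizationWeight_mem b, hsplit⟩
  have hb : b = 0 := (factorizationWeight_eq_zero_iff b).mp (by omega)
  rw [hb, add_zero, Subtype.ext hji]

theorem exists_forall_le_mem (hS : ((S : Set ℕ)ᶜ).Finite) : ∃ N, ∀ n, N ≤ n → n ∈ S := by
  obtain ⟨N, hN⟩ := hS.bddAbove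
  refine ⟨N + 1, fun n hn => ?_⟩
  by_contra h
  have := hN (show n ∈ (S : Set ℕ)ᶜ from h)
  omega

theorem multiplicityOf_spec (hS : ((S : Set ℕ)ᶜ).Finite) :
    multiplicityOf S ∈ S ∧ 0 < multiplicityOf S := by
  obtain ⟨N, hN⟩ := exists_forall_le_mem hS
  exact Nat.sInf_mem (s := {s | s ∈ S ∧ 0 < s}) ⟨N + 1, hN _ (by omega), by omega⟩

theorem multiplicityOf_le {s : ℕ} (hs : s ∈ S) (h0 : s ≠ 0) : multiplicityOf S ≤ s :=
  Nat.sInf_le ⟨hs, Nat.pos_of_ne_zero h0⟩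

theorem multiplicityOf_mem_minimalGenerators (hS : ((S : Set ℕ)ᶜ).Finite) :
    multiplicityOf S ∈ minimalGenerators S := by
  refine ⟨(multiplicityOf_spec hS).1, (multiplicityOf_spec hS).2.ne', fun s hs h0 ⟨u, _, h⟩ => ?_⟩
  have := multiplicityOf_le hs h0
  omega

theorem minimalGenerators_finite (hS : ((S : Set ℕ)ᶜ).Finite) : (minimalGenerators S).Finite := by
  obtain ⟨N, hN⟩ := exists_forall_le_mem hS
  refine (Set.finite_Iic (N + multiplicityOf S)).subset fun g hg => ?_
  by_contra h
  rw [Set.mem_Iic, not_le] at h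
  have := hg.2.2 _ (multiplicityOf_spec hS).1 (multiplicityOf_spec hS).2.ne'
    ⟨g - multiplicityOf S, hN _ (by omega), by omega⟩
  omega

end NumericalSemigroup

/-! ### The defining ideal in terms of factorizations -/

section Presentation
variable (k : Type*) [Field k] (S : AddSubmonoid ℕ)

/-- The parametrization `x_g ↦ t ^ g` of the semigroup ring. -/
noncomputable def semigroupRingPresentation :
    MvPolynomial (minimalGenerators S) k →ₐ[k] semigroupRing k S :=
  aeval fun g => tPow k g.1 g.2.1

variable {k S}

theorem semigroupRingPresentation_monomial (a : minimalGenerators S →₀ ℕ) (r : k) :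
    (semigroupRingPresentation k S (monomial a r) : PowerSeries k) =
      PowerSeries.monomial (factorizationWeight S a) r := by
  have h : ((semigroupRing k S).val.comp (semigroupRingPresentation k S)) =
      aeval fun g : minimalGenerators S => (PowerSeries.X ^ (g : ℕ) : PowerSeries k) := by
    ext g
    simp [semigroupRingPresentation, tPow]
  have h2 := congrArg (fun F => F (monomial a r)) h
  simp only [AlgHom.comp_apply, Subalgebra.coe_val] at h2
  rw [h2, aeval_monomial, Finsupp.prod, PowerSeries.algebraMap_apply]
  simp only [← pow_mul]
  rw [Finset.prod_pow_eq_pow_sum, Finsupp.weight_apply, Finsupp.sum]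
  simp only [smul_eq_mul, mul_comm (a _), Algebra.algebraMap_self, RingHom.id_apply]
  rw [PowerSeries.X_pow_eq, ← PowerSeries.smul_eq_C_mul, ← map_smul, smul_eq_mul, mul_one]

open Classical in
theorem coeff_semigroupRingPresentation (p : MvPolynomial (minimalGenerators S) k) (s : ℕ) :
    PowerSeries.coeff s (semigroupRingPresentation k S p : PowerSeries k) =
      ∑ a ∈ p.support with factorizationWeight S a = s, coeff a p := by
  conv_lhs => rw [p.as_sum, map_sum, AddSubmonoidClass.coe_finsetSum, map_sum]
  rw [Finset.sum_filter]
  refine Finset.sum_congr rfl fun a _ => ?_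
  rw [semigroupRingPresentation_monomial, PowerSeries.coeff_monomial]
  simp only [eq_comm]

theorem semigroupRingPresentation_monomial_mem_pow (a : minimalGenerators S →₀ ℕ) :
    semigroupRingPresentation k S (monomial a 1) ∈
      IsLocalRing.maximalIdeal (semigroupRing k S) ^ a.degree := by
  rw [semigroupRingPresentation, aeval_monomial, map_one, one_mul, Finsupp.degree_apply,
    ← Finset.prod_pow_eq_pow_sum]
  exact Ideal.prod_mem_prod fun i _ =>
    Ideal.pow_mem_pow (tPow_mem_maximalIdeal k i.1 i.2.1 i.2.2.1) _

/-- Elements of `𝔪` have no constant term, so each exponent in them has a factorization of positive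
length; lengths add under products. -/
theorem exists_factorization_of_mem_pow (d : ℕ) (f : semigroupRing k S)
    (hf : f ∈ IsLocalRing.maximalIdeal (semigroupRing k S) ^ d) (s : ℕ)
    (hs : PowerSeries.coeff s (f : PowerSeries k) ≠ 0) :
    ∃ a, factorizationWeight S a = s ∧ d ≤ a.degree := by
  induction d generalizing f s with
  | zero =>
    obtain ⟨a, ha⟩ := exists_factorization (f.2 s hs)
    exact ⟨a, ha, Nat.zero_le _⟩
  | succ d ih =>
    rw [pow_succ'] at hf
    induction hf using Submodule.mul_induction_on' generalizing s with
    | mem_mul_mem x hx y hy =>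
      rw [Subalgebra.coe_mul, PowerSeries.coeff_mul] at hs
      obtain ⟨p, hp, hne⟩ := Finset.exists_ne_zero_of_sum_ne_zero hs
      obtain ⟨b, hb, hbd⟩ := ih y hy p.2 (right_ne_zero_of_mul hne)
      have hx1 := left_ne_zero_of_mul hne
      obtain ⟨a, ha⟩ := exists_factorization (x.2 _ hx1)
      have ha0 : a.degree ≠ 0 := by
        intro h
        rw [Finsupp.degree_eq_zero_iff] at h
        rw [IsLocalRing.mem_maximalIdeal, mem_nonunits_iff, semigroupRing_isUnit_iff, not_not] at hx
        rw [← ha, h, map_zero, PowerSeries.coeff_zero_eq_constantCoeff_apply] at hx1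
        exact hx1 hx
      refine ⟨a + b, ?_, ?_⟩
      · rw [map_add, ha, hb, Finset.HasAntidiagonal.mem_antidiagonal.mp hp]
      · rw [map_add]
        omega
    | add x _ y _ hx hy =>
      by_cases h : PowerSeries.coeff s (x : PowerSeries k) = 0
      · refine hy s fun h' => hs ?_
        rw [Subalgebra.coe_add, map_add, h, h', add_zero]
      · exact hx s h

variable (k S) in
/-- The presentation of the Rees algebra that lifts `grPresentation`. -/
noncomputable def reesPresentation : MvPolynomial (minimalGenerators S) k →ₐ[k]
    reesAlgebra (IsLocalRing.maximalIdeal (semigroupRing k S)) :=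
  aeval fun g => ⟨Polynomial.monomial 1 (tPow k g.1 g.2.1), reesAlgebra.monomial_mem.mpr
    (by rw [pow_one]; exact tPow_mem_maximalIdeal k g.1 g.2.1 g.2.2.1)⟩

theorem grPresentation_eq_mk (p : MvPolynomial (minimalGenerators S) k) :
    grPresentation k S p = Ideal.Quotient.mk _ (reesPresentation k S p) := by
  have : grPresentation k S = (Ideal.Quotient.mkₐ k _).comp (reesPresentation k S) := by
    ext g
    simp [grPresentation, reesPresentation, assocGraded.degOne]
  rw [this]
  rfl

theorem reesPresentation_monomial (a : minimalGenerators S →₀ ℕ) (r : k) :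
    (reesPresentation k S (monomial a r) : Polynomial (semigroupRing k S)) =
      Polynomial.monomial a.degree (semigroupRingPresentation k S (monomial a r)) := by
  induction a using Finsupp.induction_linear generalizing r with
  | zero =>
    rw [map_zero, ← C_apply, ← algebraMap_eq, AlgHom.commutes, AlgHom.commutes]
    rfl
  | add a b ha hb =>
    have h : monomial (a + b) r = monomial a r * monomial b 1 := by rw [monomial_mul, mul_one]
    rw [h, map_mul, map_mul, Subalgebra.coe_mul, ha, hb, Polynomial.monomial_mul_monomial, map_add]
  | single g n =>
    rw [reesPresentation, semigroupRingPresentation, aeval_monomial, aeval_monomial,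
      Finsupp.degree_single, Finsupp.prod_single_index (by rw [pow_zero]),
      Finsupp.prod_single_index (by rw [pow_zero]), Subalgebra.coe_mul, Subalgebra.coe_pow,
      Polynomial.monomial_pow, one_mul, ← Polynomial.C_mul_monomial]
    rfl

theorem coeff_reesPresentation (p : MvPolynomial (minimalGenerators S) k) (d : ℕ) :
    (reesPresentation k S p : Polynomial (semigroupRing k S)).coeff d =
      semigroupRingPresentation k S (homogeneousComponent d p) := by
  induction p using MvPolynomial.induction_on' with
  | monomial a r =>
    rw [reesPresentation_monomial, Polynomial.coeff_monomial,
      homogeneousComponent_of_mem (isHomogeneous_monomial r rfl)]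
    simp only [eq_comm (a := d)]
    split_ifs
    · rfl
    · rw [map_zero]
  | add p q hp hq => rw [map_add, map_add, map_add, Subalgebra.coe_add, Polynomial.coeff_add, hp, hq]

/-- Vanishing in the graded ring is tested degree by degree, which turns it into a question about
the `𝔪`-adic order of power series. -/
theorem mem_grDefiningIdeal_iff (p : MvPolynomial (minimalGenerators S) k) :
    p ∈ grDefiningIdeal k S ↔ ∀ d, semigroupRingPresentation k S (homogeneousComponent d p) ∈
      IsLocalRing.maximalIdeal (semigroupRing k S) ^ (d + 1) := by
  rw [grDefiningIdeal, RingHom.mem_ker, grPresentation_eq_mk, assocGraded.mk_eq_zero_iff]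
  simp only [coeff_reesPresentation]

theorem homogeneousComponent_mem_grDefiningIdeal (p : MvPolynomial (minimalGenerators S) k)
    (hp : p ∈ grDefiningIdeal k S) (d : ℕ) : homogeneousComponent d p ∈ grDefiningIdeal k S := by
  rw [mem_grDefiningIdeal_iff] at hp ⊢
  intro e
  rw [homogeneousComponent_of_mem (homogeneousComponent_isHomogeneous d p)]
  split_ifs with h
  · rw [h]
    exact hp d
  · rw [map_zero]
    exact Ideal.zero_mem _

/-- The longer factorization `b` puts the image of `x ^ a` in `𝔪 ^ b.degree`, deeper than its own
degree shows. -/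
theorem monomial_mem_grDefiningIdeal (a b : minimalGenerators S →₀ ℕ)
    (h : factorizationWeight S a = factorizationWeight S b) (hd : a.degree < b.degree) :
    monomial a (1 : k) ∈ grDefiningIdeal k S := by
  rw [mem_grDefiningIdeal_iff]
  intro d
  rw [homogeneousComponent_of_mem (isHomogeneous_monomial 1 rfl)]
  split_ifs with had
  · have e : semigroupRingPresentation k S (monomial a 1) =
        semigroupRingPresentation k S (monomial b 1) := by
      apply Subtype.ext
      rw [semigroupRingPresentation_monomial, semigroupRingPresentation_monomial, h]
    rw [e]
    exact Ideal.pow_le_pow_right (by omega) (semigroupRingPresentation_monomial_mem_pow b)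
  · rw [map_zero]
    exact Ideal.zero_mem _

theorem monomial_sub_mem_grDefiningIdeal (a b : minimalGenerators S →₀ ℕ)
    (h : factorizationWeight S a = factorizationWeight S b) (hd : a.degree = b.degree) :
    monomial a (1 : k) - monomial b 1 ∈ grDefiningIdeal k S := by
  rw [mem_grDefiningIdeal_iff]
  intro d
  rw [map_sub, homogeneousComponent_of_mem (isHomogeneous_monomial 1 rfl),
    homogeneousComponent_of_mem (isHomogeneous_monomial 1 rfl), ← hd]
  split_ifs with had
  · have e : semigroupRingPresentation k S (monomial a 1) =
        semigroupRingPresentation k S (monomial b 1) := by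
      apply Subtype.ext
      rw [semigroupRingPresentation_monomial, semigroupRingPresentation_monomial, h]
    rw [map_sub, e, sub_self]
    exact Ideal.zero_mem _
  · rw [sub_zero, map_zero]
    exact Ideal.zero_mem _

/-- A factorization that is strictly longest, or the only longest one, of its value does not occur
in the defining ideal. -/
theorem coeff_eq_zero_of_mem_grDefiningIdeal (p : MvPolynomial (minimalGenerators S) k)
    (hp : p ∈ grDefiningIdeal k S) (a : minimalGenerators S →₀ ℕ)
    (ha : ∀ b, factorizationWeight S b = factorizationWeight S a → a.degree ≤ b.degree → b = a) :
    coeff a p = 0 := by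
  classical
  by_contra hne
  have h := (mem_grDefiningIdeal_iff p).mp hp a.degree
  -- No other monomial of this degree has the same weight, so nothing can cancel the coefficient at
  -- `a`.
  have hcoeff : PowerSeries.coeff (factorizationWeight S a)
      (semigroupRingPresentation k S (homogeneousComponent a.degree p) : PowerSeries k) =
      coeff a p := by
    rw [coeff_semigroupRingPresentation, Finset.sum_eq_single a]
    · rw [coeff_homogeneousComponent, if_pos rfl]
    · intro b hb hba
      rw [Finset.mem_filter, mem_support_iff, coeff_homogeneousComponent] at hb
      obtain ⟨h1, h2⟩ := hb
      have hd : b.degree = a.degree := by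
        by_contra hd
        exact h1 (if_neg hd)
      exact absurd (ha b h2 hd.ge) hba
    · intro hna
      by_contra h0
      exact hna (Finset.mem_filter.mpr ⟨mem_support_iff.mpr h0, rfl⟩)
  obtain ⟨b, hb, hbd⟩ := exists_factorization_of_mem_pow _ _ h _ (hcoeff ▸ hne)
  have := ha b hb (by omega)
  rw [this] at hbd
  omega

end Presentation

/-! ### A weight from strict convexity -/

/-- Among the monomials of degree `c` and weight `c * g i` the power `x_i ^ c` has the smallest
sum of squares, by strict convexity. -/
theorem weight_sq_sub_sq_lt {σ : Type*} [Fintype σ] (g : σ → ℕ) (hg : Function.Injective g) (G : ℕ)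
    (hG : ∀ i, g i ≤ G) (i : σ) (c : ℕ) (a : σ →₀ ℕ)
    (hw : Finsupp.weight g a = Finsupp.weight g (Finsupp.single i c)) (hd : a.degree = c)
    (ha : a ≠ Finsupp.single i c) :
    Finsupp.weight (fun j => G ^ 2 - g j ^ 2) a <
      Finsupp.weight (fun j => G ^ 2 - g j ^ 2) (Finsupp.single i c) := by
  have hex : ∃ j, j ≠ i ∧ a j ≠ 0 := by
    by_contra! h
    have h1 : a = Finsupp.single i (a i) := by
      ext j
      by_cases hj : j = i
      · rw [hj, Finsupp.single_eq_same]
      · rw [h j hj, Finsupp.single_eq_of_ne hj]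
    rw [h1, Finsupp.degree_single] at hd
    exact ha (hd ▸ h1)
  obtain ⟨j, hji, hj⟩ := hex
  rw [Finsupp.weight_single, Finsupp.weight_eq_sum] at hw ⊢
  rw [Finsupp.degree_eq_sum] at hd
  simp only [smul_eq_mul] at hw ⊢
  have hsub : ∀ l, ((G ^ 2 - g l ^ 2 : ℕ) : ℤ) = G ^ 2 - g l ^ 2 := fun l => by
    rw [Nat.cast_sub (Nat.pow_le_pow_left (hG l) 2)]
    push_cast
    rfl
  have hwZ : ∑ l, (a l : ℤ) * g l = c * g i := by exact_mod_cast hw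
  have hdZ : ∑ l, (a l : ℤ) = c := by exact_mod_cast hd
  -- With degree `c` and weight `c * g i` fixed, this sum equals `∑ a_l g_l ^ 2 - c * g_i ^ 2`.
  -- Subtracting the squares from `G ^ 2` reverses the inequality and keeps the weights natural
  -- numbers.
  have hpos : 0 < ∑ l, (a l : ℤ) * ((g l : ℤ) - g i) ^ 2 := by
    refine Finset.sum_pos' (fun l _ => by positivity) ⟨j, Finset.mem_univ _, ?_⟩
    have h1 : (g j : ℤ) - g i ≠ 0 := sub_ne_zero.mpr (by exact_mod_cast fun h => hji (hg h))
    have h2 : (0 : ℤ) < a j := by exact_mod_cast Nat.pos_of_ne_zero hj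
    positivity
  have hexp : ∑ l, (a l : ℤ) * ((g l : ℤ) - g i) ^ 2 =
      ∑ l, (a l : ℤ) * g l ^ 2 - 2 * g i * ∑ l, (a l : ℤ) * g l + g i ^ 2 * ∑ l, (a l : ℤ) := by
    rw [Finset.mul_sum, Finset.mul_sum, ← Finset.sum_sub_distrib, ← Finset.sum_add_distrib]
    exact Finset.sum_congr rfl fun l _ => by ring
  have hexp2 : ∑ l, (a l : ℤ) * ((G : ℤ) ^ 2 - g l ^ 2) =
      G ^ 2 * ∑ l, (a l : ℤ) - ∑ l, (a l : ℤ) * g l ^ 2 := by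
    rw [Finset.mul_sum, ← Finset.sum_sub_distrib]
    exact Finset.sum_congr rfl fun l _ => by ring
  zify
  simp only [hsub]
  rw [hexp2, hdZ]
  rw [hexp, hwZ, hdZ] at hpos
  linarith

/-! ### Bounded factorizations and residues modulo the multiplicity -/

section UniqueFactorization
variable {S : AddSubmonoid ℕ}

/-- If every element of `S` has exactly one factorization whose exponents, except that of the
multiplicity `g₁`, are below the bounds `c`, then the product of the bounds is `g₁`. -/
theorem prod_eq_of_existsUnique_factorization (hS : ((S : Set ℕ)ᶜ).Finite)
    [Fintype (minimalGenerators S)] [DecidableEq (minimalGenerators S)]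
    (g₁ : minimalGenerators S) (c : {i // i ≠ g₁} → ℕ)
    (h : ∀ s ∈ S, ∃! a, factorizationWeight S a = s ∧ ∀ i : {i // i ≠ g₁}, a i < c i) :
    ∏ i, c i = g₁ := by
  have : NeZero (g₁ : ℕ) := ⟨g₁.2.2.1⟩
  let ext : (∀ i, Fin (c i)) → minimalGenerators S →₀ ℕ := fun e =>
    Finsupp.equivFunOnFinite.symm fun i => if hi : i ≠ g₁ then (e ⟨i, hi⟩ : ℕ) else 0
  have hext : ∀ e (i : {i // i ≠ g₁}), ext e i = e i := fun e i => dif_pos i.2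
  have hext₁ : ∀ e, ext e g₁ = 0 := fun e => dif_neg (not_not.mpr rfl)
  have hsingle : ∀ (j : ℕ) (i : {i // i ≠ g₁}), Finsupp.single g₁ j (i : minimalGenerators S) = 0 :=
    fun j i => Finsupp.single_eq_of_ne i.2
  have hw₁ : ∀ j, factorizationWeight S (Finsupp.single g₁ j) = j * g₁ := fun j =>
    Finsupp.weight_single _ _ _
  -- The product formula comes from `F` being a bijection from the box of bounded exponents onto the
  -- residues modulo `g₁`.
  let F : (∀ i, Fin (c i)) → ZMod g₁ := fun e => factorizationWeight S (ext e)
  have hinj' : ∀ e e', factorizationWeight S (ext e) ≤ factorizationWeight S (ext e') →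
      F e = F e' → e = e' := by
    intro e e' hle hF
    obtain ⟨j, hj⟩ := (Nat.modEq_iff_dvd' hle).mp ((ZMod.natCast_eq_natCast_iff _ _ _).mp hF)
    -- Adding copies of `g₁` leaves the bounded exponents unchanged, so both sides are bounded
    -- factorizations of one element.
    have heq : ext e + Finsupp.single g₁ j = ext e' := by
      refine (h _ (factorizationWeight_mem (ext e'))).unique ⟨?_, fun i => ?_⟩ ⟨rfl, fun i => ?_⟩
      · rw [map_add, hw₁, mul_comm, ← hj, Nat.add_sub_cancel' hle]
      · rw [Finsupp.add_apply, hsingle, add_zero, hext]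
        exact (e i).2
      · rw [hext]
        exact (e' i).2
    funext i
    have := DFunLike.congr_fun heq (i : minimalGenerators S)
    rw [Finsupp.add_apply, hsingle, add_zero, hext, hext] at this
    exact Fin.ext this
  have hinj : Function.Injective F := by
    intro e e' hF
    rcases le_total (factorizationWeight S (ext e)) (factorizationWeight S (ext e')) with hle | hle
    · exact hinj' e e' hle hF
    · exact (hinj' e' e hle hF.symm).symm
  have hsurj : Function.Surjective F := by
    intro r
    obtain ⟨N, hN⟩ := exists_forall_le_mem hS
    -- The summand `N * g₁ ≥ N` moves the representative past all gaps without changing its residue.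
    have hs : r.val + N * g₁ ∈ S := hN _ (le_add_left (Nat.le_mul_of_pos_right _ (NeZero.pos _)))
    obtain ⟨a, ⟨ha, hlt⟩, -⟩ := h _ hs
    obtain ⟨e, he⟩ : ∃ e : ∀ i, Fin (c i), ∀ i, (e i : ℕ) = a i :=
      ⟨fun i => ⟨a i, hlt i⟩, fun _ => rfl⟩
    refine ⟨e, ?_⟩
    have hsplit : a = ext e + Finsupp.single g₁ (a g₁) := by
      ext i
      rw [Finsupp.add_apply]
      by_cases hi : i = g₁
      · rw [hi, hext₁, Finsupp.single_eq_same, zero_add]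
      · rw [hsingle _ ⟨i, hi⟩, hext e ⟨i, hi⟩, he, add_zero]
    rw [hsplit, map_add, hw₁] at ha
    have hcast := congrArg (Nat.cast : ℕ → ZMod g₁) ha
    push_cast at hcast
    simpa [F] using hcast
  have hcard := Fintype.card_of_bijective ⟨hinj, hsurj⟩
  rw [Fintype.card_pi, ZMod.card] at hcard
  simpa using hcard

/-- If each power `x_i ^ c i` has another factorization that is longer, or as long and of lower
weight `μ`, then every element of `S` has a factorization with exponents below the bounds `c`. -/
theorem exists_bounded_factorization {ι : Type*} (v : ι → minimalGenerators S) (c : ι → ℕ)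
    (μ : (minimalGenerators S →₀ ℕ) →+ ℕ)
    (hrule : ∀ i, ∃ b, factorizationWeight S b =
        factorizationWeight S (Finsupp.single (v i) (c i)) ∧
      (c i < b.degree ∨ b.degree = c i ∧ μ b < μ (Finsupp.single (v i) (c i))))
    {s : ℕ} (hs : s ∈ S) :
    ∃ a, factorizationWeight S a = s ∧ ∀ i, a (v i) < c i := by
  classical
  -- Among the factorizations of `s`, take one of maximal length, and among those one of minimal
  -- `μ`. Replacing an occurring `x_i ^ c i` would contradict one of the two choices.
  let P : ℕ → Prop := fun d => ∃ a, factorizationWeight S a = s ∧ a.degree = d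
  obtain ⟨a₀, ha₀⟩ := exists_factorization hs
  have hbound : ∀ a, factorizationWeight S a = s → a.degree ≤ s := fun a ha =>
    ha ▸ degree_le_factorizationWeight a
  set D := Nat.findGreatest P s with hD
  have hPD : P D := Nat.findGreatest_spec (hbound a₀ ha₀) ⟨a₀, ha₀, rfl⟩
  have hmax : ∀ a, factorizationWeight S a = s → a.degree ≤ D := fun a ha =>
    Nat.le_findGreatest (hbound a ha) ⟨a, ha, rfl⟩
  let Q : ℕ → Prop := fun n => ∃ a, factorizationWeight S a = s ∧ a.degree = D ∧ μ a = n
  have hQ : ∃ n, Q n := by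
    obtain ⟨a, ha, had⟩ := hPD
    exact ⟨μ a, a, ha, had, rfl⟩
  obtain ⟨a, ha, had, haμ⟩ := Nat.find_spec hQ
  refine ⟨a, ha, fun i => ?_⟩
  by_contra! hi
  obtain ⟨r, rfl⟩ := le_iff_exists_add.mp (Finsupp.single_le_iff.mpr hi)
  obtain ⟨b, hb, hlt⟩ := hrule i
  have hw : factorizationWeight S (b + r) = s := by rw [map_add, hb, ← map_add, ha]
  have h1 := hmax _ hw
  rw [map_add] at h1 had haμ
  rw [Finsupp.degree_single] at had
  rcases hlt with hlt | ⟨hbd, hlt⟩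
  · omega
  · have h2 := Nat.find_min' hQ ⟨b + r, hw, by rw [map_add]; omega, rfl⟩
    rw [map_add] at h2
    omega

end UniqueFactorization

/-! ### Pure-power relations and the product formula -/

/-- For a generator `i` other than the multiplicity, the least power of `x_i` that has another
factorization at least as long. -/
theorem exists_least_power {S : AddSubmonoid ℕ} (g₁ i : minimalGenerators S)
    (hlt : (g₁ : ℕ) < i) :
    ∃ c, 2 ≤ c ∧
      (∃ b, factorizationWeight S b = factorizationWeight S (Finsupp.single i c) ∧
        c ≤ b.degree ∧ b ≠ Finsupp.single i c) ∧
      ∀ c' < c, ∀ b, factorizationWeight S b = factorizationWeight S (Finsupp.single i c') →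
        c' ≤ b.degree → b = Finsupp.single i c' := by
  classical
  have hex : ∃ c, ∃ b, factorizationWeight S b = factorizationWeight S (Finsupp.single i c) ∧
      c ≤ b.degree ∧ b ≠ Finsupp.single i c := by
    -- The exponent `g₁` works: `g₁` copies of `i` and `i` copies of `g₁` have the same sum, and the
    -- second is longer.
    refine ⟨g₁, Finsupp.single g₁ i, ?_, ?_, ?_⟩
    · rw [Finsupp.weight_single, Finsupp.weight_single, smul_eq_mul, smul_eq_mul, mul_comm]
    · rw [Finsupp.degree_single]
      exact hlt.le
    · intro h
      have := congrArg Finsupp.degree h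
      rw [Finsupp.degree_single, Finsupp.degree_single] at this
      omega
  refine ⟨Nat.find hex, ?_, Nat.find_spec hex, fun c' hc' b hb hd => ?_⟩
  · rw [Nat.le_find_iff]
    rintro n hn ⟨b, hb, -, hne⟩
    apply hne
    interval_cases n
    · rw [Finsupp.single_zero] at hb ⊢
      exact (factorizationWeight_eq_zero_iff b).mp (by rw [hb, map_zero])
    · refine eq_single_of_factorizationWeight_eq i b ?_
      rw [hb, Finsupp.weight_single, one_smul]
  · by_contra hne
    exact Nat.find_min hex hc' ⟨b, hb, hd, hne⟩

/-- If `gr_𝔪(k⟦t^S⟧)` is a complete intersection, then the multiplicity of `S` is a product of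
`ν - 1` factors, each at least `2`. -/
theorem GrIsCompleteIntersection.exists_prod_eq {k : Type*} [Field k] {S : AddSubmonoid ℕ}
    (hS : ((S : Set ℕ)ᶜ).Finite) (hCI : GrIsCompleteIntersection k S) :
    ∃ (ι : Type) (_ : Fintype ι) (c : ι → ℕ), Fintype.card ι + 1 = embeddingDimension S ∧
      (∀ i, 2 ≤ c i) ∧ ∏ i, c i = multiplicityOf S := by
  classical
  have : Finite (minimalGenerators S) := minimalGenerators_finite hS
  let _ : Fintype (minimalGenerators S) := Fintype.ofFinite _
  let g₁ : minimalGenerators S := ⟨multiplicityOf S, multiplicityOf_mem_minimalGenerators hS⟩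
  let Y := {i // i ≠ g₁}
  have hcardY : Fintype.card Y + 1 = embeddingDimension S := by
    have h1 : Fintype.card (minimalGenerators S) = embeddingDimension S := by
      rw [embeddingDimension, ← Nat.card_coe_set_eq, Nat.card_eq_fintype_card]
    have h2 : Fintype.card Y = Fintype.card (minimalGenerators S) - 1 := by
      rw [Fintype.card_subtype_compl, Fintype.card_subtype_eq]
    have h3 : 0 < Fintype.card (minimalGenerators S) := Fintype.card_pos_iff.mpr ⟨g₁⟩
    omega
  have hlt : ∀ i : Y, (g₁ : ℕ) < i.1 := fun i =>
    lt_of_le_of_ne (multiplicityOf_le i.1.2.1 i.1.2.2.1) fun h => i.2 (Subtype.ext h.symm)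
  choose c hc2 hcb hcmin using fun i : Y => exists_least_power g₁ i.1 (hlt i)
  choose b hbw hbd hbne using hcb
  let l : Y → minimalGenerators S →₀ ℕ := fun i => Finsupp.single i.1 (c i)
  -- If `b i` is longer, the rule sends `x_i ^ c i` to zero: `ε i = 0`. The dummy exponent `0` then
  -- keeps the weight decreasing, since `μ 0 = 0`.
  let u : Y → minimalGenerators S →₀ ℕ := fun i => if (b i).degree = c i then b i else 0
  let ε : Y → k := fun i => if (b i).degree = c i then 1 else 0
  let f : Y → MvPolynomial (minimalGenerators S) k := fun i =>
    monomial (l i) 1 - ε i • monomial (u i) 1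
  have hld : ∀ i, (l i).degree = c i := fun i => Finsupp.degree_single _ _
  have hfI : ∀ i, f i ∈ grDefiningIdeal k S := by
    intro i
    by_cases h : (b i).degree = c i
    · simp only [f, u, ε, if_pos h, one_smul]
      exact monomial_sub_mem_grDefiningIdeal _ _ (hbw i).symm (by rw [h, hld])
    · simp only [f, ε, if_neg h, zero_smul, sub_zero]
      exact monomial_mem_grDefiningIdeal _ _ (hbw i).symm
        (by rw [hld]; exact lt_of_le_of_ne (hbd i) (Ne.symm h))
  have hfhom : ∀ i, (f i).IsHomogeneous (c i) := by
    intro i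
    refine (isHomogeneous_monomial 1 (hld i)).sub ?_
    by_cases h : (b i).degree = c i
    · simp only [u, ε, if_pos h, one_smul]
      exact isHomogeneous_monomial 1 h
    · simp only [ε, if_neg h, zero_smul]
      exact isHomogeneous_zero _ _ _
  have hcl : ∀ i j : Y, l i = l j → i = j := by
    intro i j h
    have h1 : l i i.1 = c i := Finsupp.single_eq_same
    by_contra hne
    have h2 : l j i.1 = 0 := Finsupp.single_eq_of_ne fun h => hne (Subtype.ext h)
    have := hc2 i
    rw [h, h2] at h1
    omega
  -- Were the tail of `f j` equal to `x_i ^ c i`, equal degrees and weights would force `i = j`, and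
  -- `b j` would be the excluded trivial factorization.
  have hcbu : ∀ i j : Y, (b j).degree = c j → b j ≠ l i := by
    intro i j hd h
    have hcc : c i = c j := by rw [← hd, h, hld]
    have hw := hbw j
    rw [h, Finsupp.weight_single, Finsupp.weight_single, hcc, smul_eq_mul, smul_eq_mul] at hw
    have hij : i = j := by
      have := hc2 j
      exact Subtype.ext (Subtype.ext (Nat.eq_of_mul_eq_mul_left (by omega) hw))
    subst hij
    exact hbne i h
  have hφf : ∀ i j, lcoeff k (l i) (f j) = if i = j then 1 else 0 := by
    intro i j
    rw [lcoeff_apply, coeff_sub, coeff_smul, coeff_monomial, coeff_monomial]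
    have h1 : ε j • (if u j = l i then (1 : k) else 0) = 0 := by
      by_cases h : (b j).degree = c j
      · simp only [u, if_pos h, if_neg (hcbu i j h), smul_zero]
      · simp only [ε, if_neg h, zero_smul]
    rw [h1, sub_zero]
    by_cases hij : i = j
    · rw [hij, if_pos rfl, if_pos rfl]
    · rw [if_neg hij, if_neg fun h => hij (hcl j i h).symm]
  -- Only `j = i` can contribute, through the coefficient of `x_i ^ (c i - 1)` in `q`; it is zero by
  -- minimality of `c i`.
  have hφX : ∀ i j, ∀ q ∈ grDefiningIdeal k S, lcoeff k (l i) (q * X j) = 0 := by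
    intro i j q hq
    rw [lcoeff_apply, coeff_mul_X']
    split_ifs with hj
    · have hij : j = i.1 := by
        by_contra hne
        exact (Finsupp.mem_support_iff.mp hj) (Finsupp.single_eq_of_ne hne)
      rw [hij, ← Finsupp.single_tsub]
      have := hc2 i
      exact coeff_eq_zero_of_mem_grDefiningIdeal q hq _ fun b' h1 h2 =>
        hcmin i (c i - 1) (by omega) b' h1 (by rwa [Finsupp.degree_single] at h2)
    · rfl
  obtain ⟨h, hh⟩ : ∃ h : Y → MvPolynomial (minimalGenerators S) k,
      Ideal.span (Set.range h) = grDefiningIdeal k S := by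
    obtain ⟨t, ht, hspan⟩ := Submodule.FG.exists_span_finset_card_eq_spanFinrank
      (IsNoetherian.noetherian (grDefiningIdeal k S))
    have hcard : Fintype.card Y = Fintype.card t := by
      rw [Fintype.card_coe, ht]
      have : _ + 1 = _ := hCI
      omega
    refine ⟨fun i => (Fintype.equivOfCardEq hcard i : MvPolynomial (minimalGenerators S) k), ?_⟩
    rw [← hspan, Ideal.span]
    congr 1
    ext p
    constructor
    · rintro ⟨i, rfl⟩
      exact (Fintype.equivOfCardEq hcard i).2
    · intro hp
      exact ⟨(Fintype.equivOfCardEq hcard).symm ⟨p, hp⟩, by simp⟩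
  have hspan := MvPolynomial.eq_span_of_dual_family (grDefiningIdeal k S)
    homogeneousComponent_mem_grDefiningIdeal f c hfI hfhom (fun i => lcoeff k (l i)) hφX hφf h hh
  -- the weight that makes the generators `f` rewriting rules
  let G : ℕ := ∑ i : minimalGenerators S, (i : ℕ) + 1
  have hG : ∀ i : minimalGenerators S, (i : ℕ) < G := fun i =>
    Nat.lt_succ_of_le (Finset.single_le_sum (f := fun i : minimalGenerators S => (i : ℕ))
      (fun _ _ => Nat.zero_le _) (Finset.mem_univ i))
  let μ : (minimalGenerators S →₀ ℕ) →+ ℕ :=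
    Finsupp.weight fun i : minimalGenerators S => G ^ 2 - (i : ℕ) ^ 2
  have hμb : ∀ i, (b i).degree = c i → μ (b i) < μ (l i) := fun i hd =>
    weight_sq_sub_sq_lt (fun i : minimalGenerators S => (i : ℕ)) Subtype.val_injective G
      (fun i => (hG i).le) i.1 (c i) (b i) (hbw i) hd (hbne i)
  have hμ : ∀ i, μ (u i) < μ (l i) := by
    intro i
    by_cases hd : (b i).degree = c i
    · simp only [u, if_pos hd]
      exact hμb i hd
    · simp only [u, if_neg hd, map_zero]
      have h1 := hc2 i
      -- Every generator is strictly below `G`, so each variable has positive weight, as the rules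
      -- with target zero require.
      have h2 := Nat.pow_lt_pow_left (hG i.1) two_ne_zero
      have h3 : μ (l i) = c i * (G ^ 2 - (i.1 : ℕ) ^ 2) := Finsupp.weight_single _ _ _
      rw [h3]
      exact Nat.mul_pos (by omega) (by omega)
  obtain ⟨L, hLnormal, hLker⟩ := MvPolynomial.exists_linearMap_of_coprime_rules l u ε μ hμ
    (by
      intro i j hij a hi hj
      have hne : (i.1 : minimalGenerators S) ≠ j.1 := fun h => hij (Subtype.ext h)
      intro x
      have h1 := hi x
      have h2 := hj x
      rw [Finsupp.add_apply]
      by_cases hx : x = i.1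
      · have : l j x = 0 := Finsupp.single_eq_of_ne (hx ▸ hne)
        omega
      · have : l i x = 0 := Finsupp.single_eq_of_ne hx
        omega)
  replace hLker : ∀ p ∈ grDefiningIdeal k S, L p = 0 := fun p hp => hLker p (hspan ▸ hp)
  replace hLnormal : ∀ a : minimalGenerators S →₀ ℕ, (∀ i : Y, a i < c i) →
      L (monomial a 1) = monomial a 1 := fun a ha =>
    hLnormal a fun i hi => (Finsupp.single_le_iff.mp hi).not_gt (ha i)
  have hone : ∀ a : minimalGenerators S →₀ ℕ, monomial a (1 : k) ≠ 0 := fun a ha =>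
    one_ne_zero (monomial_eq_zero.mp ha)
  -- Two bounded factorizations of one element would put the shorter monomial, or their difference
  -- if the lengths agree, in `I^*`; but `L` fixes these and kills `I^*`.
  have huniq : ∀ a a' : minimalGenerators S →₀ ℕ, (∀ i : Y, a i < c i) → (∀ i : Y, a' i < c i) →
      factorizationWeight S a = factorizationWeight S a' → a.degree ≤ a'.degree → a = a' := by
    intro a a' ha ha' hw hd
    rcases hd.lt_or_eq with hd | hd
    · have := hLker _ (monomial_mem_grDefiningIdeal a a' hw hd)
      rw [hLnormal a ha] at this
      exact absurd this (hone a)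
    · have := hLker _ (monomial_sub_mem_grDefiningIdeal a a' hw hd)
      rw [map_sub, hLnormal a ha, hLnormal a' ha', sub_eq_zero] at this
      exact monomial_left_injective one_ne_zero this
  have hprod := prod_eq_of_existsUnique_factorization hS g₁ c fun s hs => by
    obtain ⟨a, ha, hac⟩ := exists_bounded_factorization (fun i : Y => i.1) c μ
      (fun i => ⟨b i, hbw i, by
        rcases (hbd i).lt_or_eq with h | h
        · exact Or.inl h
        · exact Or.inr ⟨h.symm, hμb i h.symm⟩⟩) hs
    refine ⟨a, ⟨ha, hac⟩, fun a' ⟨ha', hac'⟩ => ?_⟩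
    rcases le_total a.degree a'.degree with hd | hd
    · exact (huniq a a' hac hac' (ha.trans ha'.symm) hd).symm
    · exact huniq a' a hac' hac (ha'.trans ha.symm) hd
  exact ⟨Y, inferInstance, c, hcardY, hc2, hprod⟩

/-! ### Counting prime factors -/

theorem card_le_cardFactors_prod {ι : Type*} (s : Finset ι) (c : ι → ℕ) (hc : ∀ i, 2 ≤ c i) :
    s.card ≤ ArithmeticFunction.cardFactors (∏ i ∈ s, c i) := by
  classical
  induction s using Finset.induction_on with
  | empty => simp
  | insert a s ha ih =>
    rw [Finset.prod_insert ha, Finset.card_insert_of_notMem ha, ArithmeticFunction.cardFactors_mul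
      (by have := hc a; omega) (Finset.prod_ne_zero_iff.mpr fun i _ => by have := hc i; omega)]
    have := ArithmeticFunction.cardFactors_pos_iff_one_lt.mpr (hc a)
    omega

theorem mainTheorem6 (k : Type*) [Field k] [Infinite k] (S : AddSubmonoid ℕ)
    (hS : ((S : Set ℕ)ᶜ).Finite) (hCI : GrIsCompleteIntersection k S) :
    embeddingDimension S ≤ ArithmeticFunction.cardFactors (multiplicityOf S) + 1 ∧
      ((multiplicityOf S).Prime → embeddingDimension S = 2) := by
  obtain ⟨ι, _, c, hcard, hc, hprod⟩ := hCI.exists_prod_eq hS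
  have hle := card_le_cardFactors_prod Finset.univ c hc
  rw [hprod, Finset.card_univ] at hle
  refine ⟨by omega, fun hp => ?_⟩
  rw [ArithmeticFunction.cardFactors_apply_prime hp] at hle
  -- An empty product would give multiplicity `1`, which is not prime.
  have hpos : Fintype.card ι ≠ 0 := by
    intro h0
    have := Fintype.card_eq_zero_iff.mp h0
    rw [Fintype.prod_empty] at hprod
    exact hp.one_lt.ne hprod
  omega
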